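/- Let $\beta>0$ be a constant and let $(k_n)$ be integers with $1\le k_n<n$ for all large $n$; put $\alpha_n=k_n/n$. Let $$\Xi_n=\{X\in\mathbb R^n:\ |\mathrm{Supp}(X)|\le k_n,\ |X_j|\ge\beta\ \text{ for all } j\in \mathrm{Supp}(X)\},\qquad \mathrm{Supp}(X)=\{j: X_j\neq 0\}.$$ In the input-noise model one observes $Y=G\,(X+N/\sqrt{\mathrm{SNR}})\in\mathbb R^m$, where $X\in\Xi_n$, the matrix $G\in\mathbb R^{m\times n}$ has IID $\mathcal N(0,1/m)$ entries, and the noise $N\sim\mathcal N(0,I_n)$ is independent of $G$. An estimator $\hat X$ is a measurable $\mathbb R^n$-valued function of $(G,Y)$, and its error probability is $$P_e=\mathbf E_G\ \sup_{X\in\Xi_n}\ \mathbb P\big(\mathrm{Supp}(\hat X)\ne\mathrm{Supp}(X)\,\big|\,X,G\big).$$ **(i) Necessity.** Let $\mathrm{SNR}_n>0$ and $m_n$ be sequences with $$m_n=o\!\left(\frac{n\,\max(\log n,\ \log(1/\alpha_n))}{\beta^2\,\mathrm{SNR}_n}\right).$$ Then support recovery fails: for no sequence of estimators does $P_e\to0$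 as $n\to\infty$; in fact $P_e\to 1$ for every sequence of estimators. **(ii) Sensing capacity.** Let $H_2$ be the binary entropy function in bits, and for $\varepsilon>0$ let $$C_{n,\varepsilon}=\sup\left\{\frac{nH_2(k_n/n)}{m}:\ m\ge1,\ \exists\,\hat X:\ \mathbf E_G\inf_{X\in\Xi_n}\mathbb P\Big(\tfrac1n\sum_{j=1}^n\big|\mathbf 1_{\{\hat X_j\ne0\}}-\mathbf 1_{\{X_j\neq0\}}\big|\le 0\ \Big|\ X,G\Big)\ge1-\varepsilon\right\}$$ (with $\sup\emptyset=0$). Then for every fixed $\mathrm{SNR}>0$ the sensing capacity is zero: $$\lim_{\varepsilon\to0^+}\ \limsup_{n\to\infty}\ C_{n,\varepsilon}=0.$$ More generally this holds for every sequence $\mathrm{SNR}_n>0$ with $nH_2(\alpha_n)=o\big(n\max(\log n,\log(1/\alpha_n))/(\beta^2\,\mathrm{SNR}_n)\big)$. -/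

import Mathlib

open Filter Topology Asymptotics MeasureTheory ProbabilityTheory

namespace SupportRecovery

noncomputable section

/-- The signals in `ℝⁿ` with at most `k` nonzero entries, each of absolute value at least `β`. -/
def signalSet (n k : ℕ) (β : ℝ) : Set (Fin n → ℝ) :=
  {X | (Function.support X).ncard ≤ k ∧ ∀ j ∈ Function.support X, β ≤ |X j|}

/-- The law of an `m × n` matrix with independent `N(0, 1/m)` entries. -/
def sensingLaw (m n : ℕ) : Measure (Fin m → Fin n → ℝ) :=
  Measure.pi fun _ : Fin m => Measure.pi fun _ : Fin n => gaussianReal 0 (1 / m)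

/-- The standard Gaussian law `N(0, Iₙ)`. -/
def noiseLaw (n : ℕ) : Measure (Fin n → ℝ) :=
  Measure.pi fun _ : Fin n => gaussianReal 0 1

/-- The input-noise observation `Y = G (X + N / √SNR)`. -/
def observe {m n : ℕ} (snr : ℝ) (G : Fin m → Fin n → ℝ) (X N : Fin n → ℝ) : Fin m → ℝ :=
  (Matrix.of G).mulVec (X + (1 / √snr) • N)

/-- An estimator of the signal from `m` measurements: a measurable function of the (known)
sensing matrix and of the observation. -/
structure Estimator (m n : ℕ) where
  toFun : (Fin m → Fin n → ℝ) → (Fin m → ℝ) → (Fin n → ℝ)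
  measurable_toFun : Measurable (Function.uncurry toFun)

/-- `P_e = E_G sup_{X} P(Supp X̂ ≠ Supp X | X, G)`, the supremum being over the signal set and the
probability over the noise. -/
def errorProb {m n : ℕ} (k : ℕ) (β snr : ℝ) (est : Estimator m n) : ENNReal :=
  ∫⁻ G, ⨆ X ∈ signalSet n k β,
    noiseLaw n {N | Function.support (est.toFun G (observe snr G X N)) ≠ Function.support X}
    ∂(sensingLaw m n)

/-- Exact support recovery along `n → ∞`: the error probability tends to zero. -/
def RecoversSupport (k m : ℕ → ℕ) (β : ℝ) (snr : ℕ → ℝ) (est : ∀ n, Estimator (m n) n) : Prop :=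
  Tendsto (fun n => errorProb (k n) β (snr n) (est n)) atTop (𝓝 0)

/-- The normalized support distortion `(1/n) ∑ⱼ |1{X̂ⱼ ≠ 0} - 1{Xⱼ ≠ 0}|`. -/
def supportDistortion {n : ℕ} (Xhat X : Fin n → ℝ) : ℝ :=
  (1 / n : ℝ) * ∑ j, |(Function.support Xhat).indicator (fun _ => (1 : ℝ)) j
    - (Function.support X).indicator (fun _ => (1 : ℝ)) j|

/-- `E_G inf_{X} P(distortion ≤ d₀ | X, G)`, the worst-case probability of success. -/
def successProb {m n : ℕ} (k : ℕ) (β snr d₀ : ℝ) (est : Estimator m n) : ENNReal :=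
  ∫⁻ G, ⨅ X ∈ signalSet n k β,
    noiseLaw n {N | supportDistortion (est.toFun G (observe snr G X N)) X ≤ d₀}
    ∂(sensingLaw m n)

/-- The binary entropy function in bits. -/
def H₂ (p : ℝ) : ℝ := Real.binEntropy p / Real.log 2

/-- The `ε`-sensing capacity: the supremum of the rates `n H₂(k/n) / m` over all `m ≥ 1` for which
some estimator has success probability at least `1 - ε` (zero if there is no such `m`). -/
def epsSensingCapacity (n k : ℕ) (β snr d₀ ε : ℝ) : ENNReal :=
  ⨆ (m : ℕ) (_ : 1 ≤ m ∧
      ∃ est : Estimator m n, 1 - ENNReal.ofReal ε ≤ successProb k β snr d₀ est),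
    ENNReal.ofReal (n * H₂ (k / n) / m)

/-- The sensing capacity `lim_{ε → 0⁺} limsup_{n → ∞} C_{n,ε}` exists and is equal to `C`. -/
def HasSensingCapacity (k : ℕ → ℕ) (β : ℝ) (snr : ℕ → ℝ) (d₀ : ℝ) (C : ENNReal) : Prop :=
  Tendsto (fun ε : ℝ => limsup (fun n => epsSensingCapacity n (k n) β (snr n) d₀ ε) atTop)
    (𝓝[>] 0) (𝓝 C)

/-- `n max(log n, log (1/αₙ)) / (β² SNR)` with the sparsity ratio `αₙ = k/n`. -/
def measurementScale (k : ℕ → ℕ) (β : ℝ) (snr : ℕ → ℝ) (n : ℕ) : ℝ :=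
  n * max (Real.log n) (Real.log (1 / ((k n : ℝ) / n))) / (β ^ 2 * snr n)

end

end SupportRecovery

open SupportRecovery

namespace SupportRecovery

/-! One-sparse signals `β e_i` already defeat every estimator, for each fixed `G`. Since noise
enters before `G`, replacing `β e_i` by the projection `β w_i` of it onto the row space leaves `Y`
unchanged, so observing `β e_i` is observing the zero signal with noise shifted by `β √snr w_i`. The
squared norms of the `w_i` sum to the rank of `G`, at most `m` (`exists_column_preimages`), so the
average shift energy is at most `β² snr m / n`, small against `log n`. The events "decide `{i}`"
under the zero signal are disjoint, so typically have probability of order `1/n`, and so small a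
shift cannot raise that to a constant (`noiseLaw_shift_le`). Hence some `β e_i` is recovered with
probability `O(n^(-1/4))` (`exists_signal_success_le`). Both claims follow by asymptotics. -/

/-! ### Gaussian shifts and likelihood ratios -/

lemma lintegral_pi_prod {n : ℕ} (μ : Fin n → Measure ℝ) [∀ i, IsProbabilityMeasure (μ i)]
    (f : Fin n → ℝ → ENNReal) (hf : ∀ i, Measurable (f i)) :
    ∫⁻ x, ∏ i, f i (x i) ∂(Measure.pi μ) = ∏ i, ∫⁻ y, f i y ∂(μ i) := by
  refine (lintegral_prod_eq_prod_lintegral_of_indepFun Finset.univ (fun i (x : Fin n → ℝ) => f i (x i))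
    (iIndepFun_pi fun i => (hf i).aemeasurable)
    fun i => (hf i).comp (measurable_pi_apply i)).trans ?_
  refine Finset.prod_congr rfl fun i _ => ?_
  exact (measurePreserving_eval μ i).lintegral_comp (hf i)

lemma pi_withDensity {n : ℕ} (μ : Fin n → Measure ℝ) [∀ i, IsProbabilityMeasure (μ i)]
    (f : Fin n → ℝ → ENNReal) (hf : ∀ i, Measurable (f i))
    [∀ i, SigmaFinite ((μ i).withDensity (f i))] :
    Measure.pi (fun i => (μ i).withDensity (f i)) =
      (Measure.pi μ).withDensity fun x => ∏ i, f i (x i) := by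
  refine Measure.pi_eq fun s hs => ?_
  rw [withDensity_apply _ (MeasurableSet.univ_pi hs),
    ← lintegral_indicator (MeasurableSet.univ_pi hs)]
  have h : ∀ x : Fin n → ℝ, (Set.univ.pi s).indicator (fun x => ∏ i, f i (x i)) x
      = ∏ i, (s i).indicator (f i) (x i) := by
    intro x
    by_cases hx : x ∈ Set.univ.pi s
    · rw [Set.indicator_of_mem hx]
      exact Finset.prod_congr rfl fun i _ => (Set.indicator_of_mem (hx i trivial) _).symm
    · rw [Set.indicator_of_notMem hx]
      simp only [Set.mem_pi, Set.mem_univ, true_implies, not_forall] at hx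
      obtain ⟨i, hi⟩ := hx
      exact (Finset.prod_eq_zero (Finset.mem_univ i) (Set.indicator_of_notMem hi _)).symm
  simp_rw [h]
  rw [lintegral_pi_prod μ _ fun i => (hf i).indicator (hs i)]
  refine Finset.prod_congr rfl fun i _ => ?_
  rw [lintegral_indicator (hs i), withDensity_apply _ (hs i)]

lemma gaussianReal_eq_withDensity (h : ℝ) :
    gaussianReal h 1 =
      (gaussianReal 0 1).withDensity fun x => ENNReal.ofReal (Real.exp (h * x - h ^ 2 / 2)) := by
  rw [gaussianReal_of_var_ne_zero _ one_ne_zero, gaussianReal_of_var_ne_zero _ one_ne_zero,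
    ← withDensity_mul _ (measurable_gaussianPDF 0 1) (by fun_prop)]
  congr 1
  funext x
  rw [Pi.mul_apply, gaussianPDF, gaussianPDF, ← ENNReal.ofReal_mul (gaussianPDFReal_nonneg _ _ _),
    gaussianPDFReal, gaussianPDFReal, mul_assoc _ (Real.exp _), ← Real.exp_add]
  congr 3
  simp
  ring

/-- The likelihood ratio of `N(h, Iₙ)` with respect to `N(0, Iₙ)`. -/
noncomputable def likelihoodRatio {n : ℕ} (h x : Fin n → ℝ) : ENNReal :=
  ∏ i, ENNReal.ofReal (Real.exp (h i * x i - h i ^ 2 / 2))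

lemma likelihoodRatio_eq {n : ℕ} (h x : Fin n → ℝ) :
    likelihoodRatio h x = ENNReal.ofReal (Real.exp (∑ i, (h i * x i - h i ^ 2 / 2))) := by
  rw [likelihoodRatio, Real.exp_sum, ENNReal.ofReal_prod_of_nonneg fun i _ => (Real.exp_pos _).le]

lemma measurable_likelihoodRatio {n : ℕ} (h : Fin n → ℝ) : Measurable (likelihoodRatio h) := by
  unfold likelihoodRatio
  fun_prop

lemma noiseLaw_map_add {n : ℕ} (h : Fin n → ℝ) :
    (noiseLaw n).map (· + h) = (noiseLaw n).withDensity (likelihoodRatio h) := by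
  have hprob : ∀ i, IsProbabilityMeasure ((gaussianReal 0 1).withDensity
      fun x => ENNReal.ofReal (Real.exp (h i * x - h i ^ 2 / 2))) := fun i => by
    rw [← gaussianReal_eq_withDensity]; infer_instance
  have hmap : ∀ i, (gaussianReal 0 1).map (· + h i) = (gaussianReal 0 1).withDensity
      fun x => ENNReal.ofReal (Real.exp (h i * x - h i ^ 2 / 2)) := fun i => by
    rw [gaussianReal_map_add_const, zero_add, gaussianReal_eq_withDensity]
  have hsf : ∀ i, SigmaFinite ((gaussianReal 0 1).map (· + h i)) := fun i => by
    rw [hmap]; infer_instance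
  have h1 := Measure.pi_map_pi (μ := fun _ : Fin n => gaussianReal 0 1)
    (f := fun i x => x + h i) fun i => by fun_prop
  have h2 := pi_withDensity (fun _ : Fin n => gaussianReal 0 1)
    (fun i x => ENNReal.ofReal (Real.exp (h i * x - h i ^ 2 / 2))) fun i => by fun_prop
  simp_rw [hmap, h2] at h1
  exact h1

instance {n : ℕ} : IsProbabilityMeasure (noiseLaw n) := by
  unfold noiseLaw; infer_instance

instance {m n : ℕ} : IsProbabilityMeasure (sensingLaw m n) := by
  unfold sensingLaw; infer_instance

lemma lintegral_likelihoodRatio {n : ℕ} (h : Fin n → ℝ) :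
    ∫⁻ x, likelihoodRatio h x ∂(noiseLaw n) = 1 := by
  rw [← setLIntegral_univ, ← withDensity_apply _ MeasurableSet.univ, ← noiseLaw_map_add,
    Measure.map_apply (by fun_prop) MeasurableSet.univ, Set.preimage_univ, measure_univ]

/-- Truncation at `t`: `L ≤ t + L² / t`, and completing the square turns `L²` into `exp ‖h‖²` times
the likelihood ratio of the doubled shift. -/
lemma likelihoodRatio_le {n : ℕ} (h x : Fin n → ℝ) {t : ℝ} (ht : 0 < t) :
    likelihoodRatio h x ≤ ENNReal.ofReal t +
      ENNReal.ofReal (Real.exp (∑ i, h i ^ 2) / t) * likelihoodRatio (fun i => 2 * h i) x := by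
  rw [likelihoodRatio_eq, likelihoodRatio_eq, ← ENNReal.ofReal_mul (by positivity),
    ← ENNReal.ofReal_add ht.le (by positivity)]
  refine ENNReal.ofReal_le_ofReal ?_
  have h2 : Real.exp (∑ i, h i ^ 2) / t * Real.exp (∑ i, (2 * h i * x i - (2 * h i) ^ 2 / 2))
      = Real.exp (∑ i, (h i * x i - h i ^ 2 / 2)) ^ 2 / t := by
    rw [div_mul_eq_mul_div, ← Real.exp_add, ← Finset.sum_add_distrib, ← Real.exp_nat_mul,
      Finset.mul_sum]
    congr 3
    funext i
    push_cast
    ring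
  rw [h2]
  set L := Real.exp (∑ i, (h i * x i - h i ^ 2 / 2))
  have hL : 0 < L := Real.exp_pos _
  rcases le_total L t with hLt | hLt
  · have : 0 ≤ L ^ 2 / t := by positivity
    linarith
  · have : L ≤ L ^ 2 / t := by
      rw [le_div_iff₀ ht, sq]
      exact mul_le_mul_of_nonneg_left hLt hL.le
    linarith

/-- Shifting the standard Gaussian by `h` increases the measure of a set in a controlled way. -/
lemma noiseLaw_shift_le {n : ℕ} (h : Fin n → ℝ) {B : Set (Fin n → ℝ)} (hB : MeasurableSet B)
    {t : ℝ} (ht : 0 < t) :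
    noiseLaw n {N | N + h ∈ B} ≤
      ENNReal.ofReal t * noiseLaw n B + ENNReal.ofReal (Real.exp (∑ i, h i ^ 2) / t) := by
  calc noiseLaw n {N | N + h ∈ B} = (noiseLaw n).map (· + h) B :=
        (Measure.map_apply (by fun_prop) hB).symm
    _ = ∫⁻ x in B, likelihoodRatio h x ∂(noiseLaw n) := by
        rw [noiseLaw_map_add, withDensity_apply _ hB]
    _ ≤ ∫⁻ x in B, (ENNReal.ofReal t + ENNReal.ofReal (Real.exp (∑ i, h i ^ 2) / t) *
          likelihoodRatio (fun i => 2 * h i) x) ∂(noiseLaw n) :=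
        lintegral_mono fun x => likelihoodRatio_le h x ht
    _ = ENNReal.ofReal t * noiseLaw n B + ENNReal.ofReal (Real.exp (∑ i, h i ^ 2) / t) *
          ∫⁻ x in B, likelihoodRatio (fun i => 2 * h i) x ∂(noiseLaw n) := by
        rw [lintegral_add_left measurable_const, setLIntegral_const,
          lintegral_const_mul _ (measurable_likelihoodRatio _)]
    _ ≤ _ := by
        gcongr
        -- Over the whole space the doubled-shift ratio is a probability density.
        refine (mul_le_mul_right (setLIntegral_le_lintegral _ _) _).trans ?_
        rw [lintegral_likelihoodRatio, mul_one]

/-! ### Shift energy and the rank of `G` -/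

/-- The columns of `G` have preimages of total squared norm at most the rank of `G`: the
projections of the basis vectors to the row space. -/
lemma exists_column_preimages {m n : ℕ} (G : Fin m → Fin n → ℝ) :
    ∃ w : Fin n → Fin n → ℝ,
      (∀ i, (Matrix.of G).mulVec (w i) = (Matrix.of G).mulVec (Pi.single i 1)) ∧
      ∑ i, ∑ j, w i j ^ 2 ≤ m := by
  obtain ⟨f, hf⟩ : ∃ f : EuclideanSpace ℝ (Fin n) →ₗ[ℝ] EuclideanSpace ℝ (Fin m),
      ∀ x, (f x).ofLp = (Matrix.of G).mulVec x.ofLp := ⟨Matrix.toLpLin 2 2 (Matrix.of G),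
    fun x => by rw [Matrix.toLpLin_apply]⟩
  obtain ⟨K, hK⟩ : ∃ K, K = (LinearMap.ker f)ᗮ := ⟨_, rfl⟩
  have hKo : Kᗮ = LinearMap.ker f := by rw [hK, Submodule.orthogonal_orthogonal]
  set b := EuclideanSpace.basisFun (Fin n) ℝ
  have hbi : ∀ i, b i = EuclideanSpace.single i 1 := fun i => by simp [b]
  refine ⟨fun i => (K.starProjection (b i)).ofLp, fun i => ?_, ?_⟩
  · have hmem : b i - K.starProjection (b i) ∈ LinearMap.ker f := by
      have := K.sub_starProjection_mem_orthogonal (b i)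
      rwa [hKo] at this
    have h0 : f (K.starProjection (b i)) = f (b i) := by
      rw [LinearMap.mem_ker, map_sub, sub_eq_zero] at hmem
      exact hmem.symm
    have h1 := congrArg WithLp.ofLp h0
    rw [hf, hf] at h1
    simpa [hbi] using h1
  · have hproj : LinearMap.IsProj K (K.starProjection : _ →ₗ[ℝ] EuclideanSpace ℝ (Fin n)) :=
      ⟨fun x => K.starProjection_apply_mem x,
        fun x hx => K.starProjection_eq_self_iff.mpr hx⟩
    -- The trace of a projection is its rank, and its diagonal entries are the squared norms of the
    -- projected basis vectors.
    have htr := hproj.trace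
    rw [LinearMap.trace_eq_sum_inner _ b] at htr
    have hsq : ∀ i, ∑ j, (K.starProjection (b i)).ofLp j ^ 2
        = inner ℝ (b i) ((K.starProjection : _ →ₗ[ℝ] EuclideanSpace ℝ (Fin n)) (b i)) := by
      intro i
      rw [ContinuousLinearMap.coe_coe, ← EuclideanSpace.real_norm_sq_eq,
        ← real_inner_self_eq_norm_sq, Submodule.inner_starProjection_left_eq_right,
        K.starProjection_eq_self_iff.mpr (K.starProjection_apply_mem _)]
    simp_rw [hsq]
    rw [htr]
    have h1 := LinearMap.finrank_range_add_finrank_ker f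
    have h2 := (LinearMap.ker f).finrank_add_finrank_orthogonal
    rw [← hK] at h2
    have h3 := (LinearMap.range f).finrank_le
    rw [finrank_euclideanSpace_fin] at h3
    have : Module.finrank ℝ K ≤ m := by omega
    exact_mod_cast this

/-! ### A badly recovered signal for every matrix -/

lemma measurableSet_support_eq {n : ℕ} (S : Set (Fin n)) :
    MeasurableSet {x : Fin n → ℝ | Function.support x = S} := by
  have : {x : Fin n → ℝ | Function.support x = S} =
      ⋂ j, {x : Fin n → ℝ | x j ≠ 0 ↔ j ∈ S} := by
    ext x
    simp [Set.ext_iff]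
  rw [this]
  refine MeasurableSet.iInter fun j => ?_
  have h0 : MeasurableSet {x : Fin n → ℝ | x j = 0} :=
    measurableSet_eq_fun (measurable_pi_apply j) measurable_const
  by_cases hj : j ∈ S
  · simp only [hj, iff_true]
    exact h0.compl
  · simp only [hj, iff_false, not_not]
    exact h0

lemma measurable_observe {m n : ℕ} (snr : ℝ) (G : Fin m → Fin n → ℝ) (X : Fin n → ℝ) :
    Measurable (observe snr G X) := by
  unfold observe
  refine measurable_pi_lambda _ fun i => ?_
  simp only [Matrix.mulVec, dotProduct]
  fun_prop

lemma Estimator.measurableSet_support_eq {m n : ℕ} (est : Estimator m n) (snr : ℝ)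
    (G : Fin m → Fin n → ℝ) (X : Fin n → ℝ) (S : Set (Fin n)) :
    MeasurableSet {N | Function.support (est.toFun G (observe snr G X N)) = S} := by
  have h : Measurable fun N => est.toFun G (observe snr G X N) :=
    est.measurable_toFun.comp (measurable_const.prodMk (measurable_observe snr G X))
  exact h (SupportRecovery.measurableSet_support_eq S)

lemma observe_eq_observe_zero {m n : ℕ} {snr : ℝ} (hsnr : 0 < snr) (G : Fin m → Fin n → ℝ)
    {X w : Fin n → ℝ} (hw : (Matrix.of G).mulVec w = (Matrix.of G).mulVec X) (N : Fin n → ℝ) :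
    observe snr G X N = observe snr G 0 (N + √snr • w) := by
  have hs : √snr ≠ 0 := (Real.sqrt_pos.mpr hsnr).ne'
  rw [observe, observe, zero_add, smul_add, smul_smul, one_div, inv_mul_cancel₀ hs, one_smul,
    Matrix.mulVec_add, Matrix.mulVec_add, hw, add_comm]

lemma single_mem_signalSet {n k : ℕ} {β : ℝ} (hβ : 0 < β) (hk : 1 ≤ k) (i : Fin n) :
    Pi.single i β ∈ signalSet n k β := by
  have hs : Function.support (Pi.single i β : Fin n → ℝ) = {i} :=
    Pi.support_single_of_ne hβ.ne'
  refine ⟨by rw [hs, Set.ncard_singleton]; exact hk, ?_⟩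
  rw [hs]
  rintro j rfl
  simp [le_abs_self]

/-- For every sensing matrix with too few rows, some one-sparse signal is missed. -/
lemma exists_signal_success_le {m n k : ℕ} {β snr : ℝ} (hβ : 0 < β) (hsnr : 0 < snr) (hk : 1 ≤ k)
    (hn : 2 ≤ n) (hm : m * (β ^ 2 * snr) ≤ n * Real.log n / 4) (est : Estimator m n)
    (G : Fin m → Fin n → ℝ) :
    ∃ X ∈ signalSet n k β,
      noiseLaw n {N | Function.support (est.toFun G (observe snr G X N)) = Function.support X} ≤
        ENNReal.ofReal (3 * (n : ℝ) ^ (-(1 / 4) : ℝ)) := by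
  obtain ⟨w, hw, hwm⟩ := exists_column_preimages G
  have hn0 : (0 : ℝ) < n := by positivity
  have hlog : 0 < Real.log n := Real.log_pos (by exact_mod_cast hn)
  set c := β * √snr with hc
  have hc2 : c ^ 2 = β ^ 2 * snr := by rw [hc, mul_pow, Real.sq_sqrt hsnr.le]
  set B : Fin n → Set (Fin n → ℝ) :=
    fun i => {N | Function.support (est.toFun G (observe snr G 0 N)) = {i}} with hB
  have hBm : ∀ i, MeasurableSet (B i) := fun i => est.measurableSet_support_eq snr G 0 {i}
  have hdisj : Pairwise (Function.onFun Disjoint B) := by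
    intro i j hij
    refine Set.disjoint_left.mpr fun N hi hj => hij ?_
    simp only [hB, Set.mem_ofPred_eq] at hi hj
    exact Set.singleton_injective (hi.symm.trans hj)
  have hsum : ∑ i, (noiseLaw n).real (B i) ≤ 1 := by
    rw [← measureReal_iUnion_fintype hdisj hBm]
    exact measureReal_le_one
  set T := n * Real.log n / 4 with hT
  have hTpos : 0 < T := by positivity
  have hsumh : ∑ i, (∑ j, (c * w i j) ^ 2) / T ≤ 1 := by
    rw [← Finset.sum_div, div_le_one hTpos]
    simp_rw [mul_pow, ← Finset.mul_sum]
    rw [hc2]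
    calc β ^ 2 * snr * ∑ i, ∑ j, w i j ^ 2 ≤ β ^ 2 * snr * m := by gcongr
      _ ≤ T := by rw [mul_comm]; exact hm
  have hne : (Finset.univ : Finset (Fin n)).Nonempty := ⟨⟨0, by omega⟩, Finset.mem_univ _⟩
  -- Both sums are at most 1, so one index satisfies both bounds: probability at most `2/n` and
  -- energy at most `2T/n = (log n)/2`.
  obtain ⟨i, -, hi⟩ := Finset.exists_le_of_sum_le
    (f := fun i => (noiseLaw n).real (B i) + (∑ j, (c * w i j) ^ 2) / T)
    (g := fun _ : Fin n => 2 / (n : ℝ)) hne (by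
      rw [Finset.sum_add_distrib, Finset.sum_const, Finset.card_univ, Fintype.card_fin,
        nsmul_eq_mul, mul_div_cancel₀ _ hn0.ne']
      linarith)
  have hBi : (noiseLaw n).real (B i) ≤ 2 / n := by
    have : 0 ≤ (∑ j, (c * w i j) ^ 2) / T := by positivity
    linarith
  have hhi : ∑ j, (c * w i j) ^ 2 ≤ Real.log n / 2 := by
    have h0 : 0 ≤ (noiseLaw n).real (B i) := measureReal_nonneg
    have h1 : (∑ j, (c * w i j) ^ 2) / T ≤ 2 / n := by linarith
    rw [div_le_iff₀ hTpos] at h1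
    refine h1.trans_eq ?_
    rw [hT]; field_simp; ring
  refine ⟨Pi.single i β, single_mem_signalSet hβ hk i, ?_⟩
  have hwX : (Matrix.of G).mulVec (β • w i) = (Matrix.of G).mulVec (Pi.single i β) := by
    rw [Matrix.mulVec_smul, hw, ← Matrix.mulVec_smul, ← Pi.single_smul, smul_eq_mul, mul_one]
  have hset : {N | Function.support (est.toFun G (observe snr G (Pi.single i β) N))
      = Function.support (Pi.single i β : Fin n → ℝ)} = {N | N + (fun j => c * w i j) ∈ B i} := by
    have hcw : (fun j => c * w i j) = √snr • β • w i := by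
      funext j
      simp only [hc, Pi.smul_apply, smul_eq_mul]
      ring
    ext N
    rw [Set.mem_ofPred_eq, Set.mem_ofPred_eq, observe_eq_observe_zero hsnr G hwX,
      Pi.support_single_of_ne hβ.ne', hcw]
    rfl
  rw [hset]
  -- The threshold `n^(3/4)` balances `t · 2/n` against `n^(1/2) / t`; both are of order `n^(-1/4)`.
  have ht : (0 : ℝ) < (n : ℝ) ^ (3 / 4 : ℝ) := by positivity
  refine (noiseLaw_shift_le _ (hBm i) ht).trans ?_
  rw [← ofReal_measureReal (μ := noiseLaw n) (s := B i), ← ENNReal.ofReal_mul ht.le,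
    ← ENNReal.ofReal_add (by positivity) (by positivity)]
  refine ENNReal.ofReal_le_ofReal ?_
  have h1 : (n : ℝ) ^ (3 / 4 : ℝ) * (noiseLaw n).real (B i) ≤ 2 * (n : ℝ) ^ (-(1 / 4) : ℝ) := by
    have : (n : ℝ) ^ (-(1 / 4) : ℝ) = (n : ℝ) ^ (3 / 4 : ℝ) / n := by
      rw [← Real.rpow_sub_one hn0.ne']; norm_num
    rw [this]
    calc (n : ℝ) ^ (3 / 4 : ℝ) * (noiseLaw n).real (B i) ≤ (n : ℝ) ^ (3 / 4 : ℝ) * (2 / n) := by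
          gcongr
      _ = _ := by ring
  have h2 : Real.exp (∑ j, (c * w i j) ^ 2) / (n : ℝ) ^ (3 / 4 : ℝ) ≤
      (n : ℝ) ^ (-(1 / 4) : ℝ) := by
    rw [div_le_iff₀ ht, ← Real.rpow_add hn0, Real.rpow_def_of_pos hn0]
    refine Real.exp_le_exp.mpr (hhi.trans_eq ?_)
    ring
  linarith

lemma support_eq_of_supportDistortion_nonpos {n : ℕ} (hn : n ≠ 0) {Xhat X : Fin n → ℝ}
    (h : supportDistortion Xhat X ≤ 0) : Function.support Xhat = Function.support X := by
  have hn0 : (0 : ℝ) < 1 / n := by positivity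
  have hsum : ∑ j, |(Function.support Xhat).indicator (fun _ => (1 : ℝ)) j
      - (Function.support X).indicator (fun _ => (1 : ℝ)) j| = 0 :=
    le_antisymm (nonpos_of_mul_nonpos_right h hn0) (Finset.sum_nonneg fun _ _ => abs_nonneg _)
  rw [Finset.sum_eq_zero_iff_of_nonneg fun _ _ => abs_nonneg _] at hsum
  ext j
  have hj := sub_eq_zero.mp (abs_eq_zero.mp (hsum j (Finset.mem_univ j)))
  by_cases h1 : j ∈ Function.support Xhat <;> by_cases h2 : j ∈ Function.support X <;>
    simp_all

/-! ### Averaging over `G` and asymptotics -/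

section bounds

variable {m n k : ℕ} {β snr : ℝ}

lemma le_errorProb (hβ : 0 < β) (hsnr : 0 < snr) (hk : 1 ≤ k)
    (hn : 2 ≤ n) (hm : m * (β ^ 2 * snr) ≤ n * Real.log n / 4) (est : Estimator m n) :
    1 - ENNReal.ofReal (3 * (n : ℝ) ^ (-(1 / 4) : ℝ)) ≤ errorProb k β snr est := by
  have h : ∀ G : Fin m → Fin n → ℝ, 1 - ENNReal.ofReal (3 * (n : ℝ) ^ (-(1 / 4) : ℝ)) ≤
      ⨆ X ∈ signalSet n k β,
        noiseLaw n {N | Function.support (est.toFun G (observe snr G X N)) ≠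
          Function.support X} := by
    intro G
    obtain ⟨X, hX, hle⟩ := exists_signal_success_le hβ hsnr hk hn hm est G
    refine le_trans ?_ (le_iSup₂_of_le X hX le_rfl)
    rw [tsub_le_iff_left]
    refine le_trans ?_ (add_le_add_left hle _)
    rw [← measure_univ (μ := noiseLaw n)]
    refine (measure_mono fun N _ => ?_).trans (measure_union_le _ _)
    exact em _
  calc _ = ∫⁻ _ : Fin m → Fin n → ℝ, (1 - ENNReal.ofReal (3 * (n : ℝ) ^ (-(1 / 4) : ℝ)))
        ∂(sensingLaw m n) := by rw [lintegral_const, measure_univ, mul_one]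
    _ ≤ _ := lintegral_mono h

lemma errorProb_le_one (est : Estimator m n) : errorProb k β snr est ≤ 1 := by
  calc errorProb k β snr est ≤ ∫⁻ _, 1 ∂(sensingLaw m n) :=
        lintegral_mono fun G => iSup₂_le fun X _ => prob_le_one
    _ = 1 := by rw [lintegral_const, measure_univ, mul_one]

lemma successProb_le (hβ : 0 < β) (hsnr : 0 < snr) (hk : 1 ≤ k)
    (hn : 2 ≤ n) (hm : m * (β ^ 2 * snr) ≤ n * Real.log n / 4) (est : Estimator m n) :
    successProb k β snr 0 est ≤ ENNReal.ofReal (3 * (n : ℝ) ^ (-(1 / 4) : ℝ)) := by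
  have h : ∀ G : Fin m → Fin n → ℝ, ⨅ X ∈ signalSet n k β,
      noiseLaw n {N | supportDistortion (est.toFun G (observe snr G X N)) X ≤ 0} ≤
        ENNReal.ofReal (3 * (n : ℝ) ^ (-(1 / 4) : ℝ)) := by
    intro G
    obtain ⟨X, hX, hle⟩ := exists_signal_success_le hβ hsnr hk hn hm est G
    refine iInf₂_le_of_le X hX (le_trans (measure_mono fun N hN => ?_) hle)
    exact support_eq_of_supportDistortion_nonpos (by omega) hN
  calc successProb k β snr 0 est
      ≤ ∫⁻ _ : Fin m → Fin n → ℝ, ENNReal.ofReal (3 * (n : ℝ) ^ (-(1 / 4) : ℝ))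
        ∂(sensingLaw m n) := lintegral_mono h
    _ = _ := by rw [lintegral_const, measure_univ, mul_one]

end bounds

/-- As `k ≥ 1`, `1/αₙ = n/k ≤ n`, so the maximum is always `log n`. -/
lemma measurementScale_eq {k : ℕ → ℕ} (β : ℝ) (snr : ℕ → ℝ) {n : ℕ} (hk : 1 ≤ k n) (hn : k n < n) :
    measurementScale k β snr n = n * Real.log n / (β ^ 2 * snr n) := by
  have hk0 : (0 : ℝ) < k n := by exact_mod_cast hk
  have hn0 : (0 : ℝ) < n := by exact_mod_cast (by omega : 0 < n)
  rw [measurementScale, max_eq_left]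
  rw [one_div_div]
  refine Real.log_le_log (by positivity) (div_le_self hn0.le ?_)
  exact_mod_cast hk

lemma tendsto_success_bound :
    Tendsto (fun n : ℕ => ENNReal.ofReal (3 * (n : ℝ) ^ (-(1 / 4) : ℝ))) atTop (𝓝 0) := by
  have h : Tendsto (fun n : ℕ => 3 * (n : ℝ) ^ (-(1 / 4) : ℝ)) atTop (𝓝 (3 * 0)) :=
    ((tendsto_rpow_neg_atTop (by norm_num)).comp tendsto_natCast_atTop_atTop).const_mul 3
  simpa using ENNReal.tendsto_ofReal h

variable {β : ℝ} {k : ℕ → ℕ}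

lemma tendsto_errorProb_one (hβ : 0 < β) (hk : ∀ᶠ n in atTop, 1 ≤ k n ∧ k n < n)
    {snr : ℕ → ℝ} {m : ℕ → ℕ} (hsnr : ∀ᶠ n in atTop, 0 < snr n)
    (hm : (fun n => (m n : ℝ)) =o[atTop] measurementScale k β snr)
    (est : ∀ n, Estimator (m n) n) :
    Tendsto (fun n => errorProb (k n) β (snr n) (est n)) atTop (𝓝 1) := by
  have hlow : Tendsto (fun n : ℕ => 1 - ENNReal.ofReal (3 * (n : ℝ) ^ (-(1 / 4) : ℝ))) atTop
      (𝓝 1) := by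
    simpa using ENNReal.Tendsto.sub tendsto_const_nhds tendsto_success_bound
      (Or.inl ENNReal.one_ne_top)
  refine tendsto_of_tendsto_of_tendsto_of_le_of_le' hlow tendsto_const_nhds ?_
    (Eventually.of_forall fun n => errorProb_le_one _)
  filter_upwards [hk, hsnr, hm.bound (by norm_num : (0 : ℝ) < 1 / 4)] with n hkn hs hmn
  refine le_errorProb hβ hs hkn.1 (by omega) ?_ _
  have hlog : 0 ≤ Real.log n := Real.log_natCast_nonneg n
  rw [measurementScale_eq β snr hkn.1 hkn.2, Real.norm_of_nonneg (by positivity),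
    Real.norm_of_nonneg (by positivity), mul_div_assoc', le_div_iff₀ (by positivity)] at hmn
  linarith

lemma hasSensingCapacity_zero (hβ : 0 < β) (hk : ∀ᶠ n in atTop, 1 ≤ k n ∧ k n < n)
    {snr : ℕ → ℝ} (hsnr : ∀ᶠ n in atTop, 0 < snr n)
    (hrate : (fun n : ℕ => n * H₂ ((k n : ℝ) / n)) =o[atTop] measurementScale k β snr) :
    HasSensingCapacity k β snr 0 0 := by
  refine tendsto_const_nhds.congr' ?_
  -- The limsup already vanishes for each `ε < 1`.
  filter_upwards [nhdsWithin_le_nhds (Iio_mem_nhds (zero_lt_one' ℝ))] with ε hε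
  refine (Tendsto.limsup_eq ?_).symm
  rw [ENNReal.tendsto_nhds_zero]
  intro c hc
  obtain ⟨d, hd0, hdc⟩ : ∃ d : ℝ, 0 < d ∧ ENNReal.ofReal d ≤ c := by
    obtain ⟨d, hd0, hdc⟩ := ENNReal.lt_iff_exists_nnreal_btwn.mp hc
    exact ⟨d, by exact_mod_cast hd0, by simpa using hdc.le⟩
  have hε1 : (0 : ENNReal) < 1 - ENNReal.ofReal ε := by
    rw [tsub_pos_iff_lt, ENNReal.ofReal_lt_one]
    exact hε
  filter_upwards [hk, hsnr, hrate.bound (by positivity : 0 < d / 4),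
    tendsto_success_bound.eventually (Iio_mem_nhds hε1)] with n hkn hs hr hsmall
  refine (iSup₂_le fun m hm => ?_).trans hdc
  obtain ⟨hm1, est, hest⟩ := hm
  have hm0 : (0 : ℝ) < m := by exact_mod_cast hm1
  -- An admissible `m` is thus at least a quarter of the scale, whence the constant `d / 4` above.
  have hmlarge : n * Real.log n / 4 < m * (β ^ 2 * snr n) := by
    by_contra! hle
    exact absurd (hest.trans (successProb_le hβ hs hkn.1 (by omega) hle est)) (not_le.mpr hsmall)
  have hlog : 0 ≤ Real.log n := Real.log_natCast_nonneg n
  refine ENNReal.ofReal_le_ofReal ?_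
  rw [div_le_iff₀ hm0]
  rw [measurementScale_eq β snr hkn.1 hkn.2, Real.norm_of_nonneg (by positivity :
    0 ≤ n * Real.log n / (β ^ 2 * snr n))] at hr
  refine (le_abs_self _).trans (hr.trans ?_)
  rw [mul_div_assoc', div_le_iff₀ (by positivity)]
  nlinarith

/-- Entropy is at most one bit, while the scale exceeds `n` by a factor of order `log n`. -/
lemma rate_isLittleO_measurementScale (hβ : 0 < β) (hk : ∀ᶠ n in atTop, 1 ≤ k n ∧ k n < n)
    {snr : ℝ} (hsnr : 0 < snr) :
    (fun n : ℕ => n * H₂ ((k n : ℝ) / n)) =o[atTop] measurementScale k β fun _ => snr := by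
  rw [isLittleO_iff]
  intro c hc
  have hlog : Tendsto (fun n : ℕ => Real.log n) atTop atTop :=
    Real.tendsto_log_atTop.comp tendsto_natCast_atTop_atTop
  filter_upwards [hk, hlog.eventually_ge_atTop (β ^ 2 * snr / c)] with n hkn hn
  have hl2 : 0 < Real.log 2 := Real.log_pos one_lt_two
  have hlog0 : 0 ≤ Real.log n := Real.log_natCast_nonneg n
  have hn0 : (0 : ℝ) < n := by exact_mod_cast (by omega : 0 < n)
  have hH0 : 0 ≤ H₂ ((k n : ℝ) / n) :=
    div_nonneg (Real.binEntropy_nonneg (by positivity)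
      ((div_le_one hn0).mpr (by exact_mod_cast hkn.2.le))) hl2.le
  have hH1 : H₂ ((k n : ℝ) / n) ≤ 1 := (div_le_one hl2).mpr Real.binEntropy_le_log_two
  rw [measurementScale_eq _ _ hkn.1 hkn.2, Real.norm_of_nonneg (by positivity),
    Real.norm_of_nonneg (by positivity)]
  rw [div_le_iff₀ hc] at hn
  have hP : 0 < β ^ 2 * snr := by positivity
  calc n * H₂ ((k n : ℝ) / n) ≤ n * 1 := by gcongr
    _ ≤ c * (n * Real.log n / (β ^ 2 * snr)) := by
      rw [mul_div_assoc', le_div_iff₀ hP, mul_one]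
      calc n * (β ^ 2 * snr) ≤ n * (Real.log n * c) := by gcongr
        _ = _ := by ring

end SupportRecovery

theorem theorem3p3 (β : ℝ) (hβ : 0 < β) (k : ℕ → ℕ)
    (hk : ∀ᶠ n in atTop, 1 ≤ k n ∧ k n < n) :
    -- too few measurements: no sequence of estimators recovers the support, and `P_e → 1`
    (∀ (snr : ℕ → ℝ) (m : ℕ → ℕ), (∀ᶠ n in atTop, 0 < snr n) →
      (fun n => (m n : ℝ)) =o[atTop] measurementScale k β snr →
      ∀ est : ∀ n, Estimator (m n) n,
        ¬ RecoversSupport k m β snr est ∧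
        Tendsto (fun n => errorProb (k n) β (snr n) (est n)) atTop (𝓝 1)) ∧
    -- the sensing capacity is zero at every fixed SNR
    (∀ snr : ℝ, 0 < snr → HasSensingCapacity k β (fun _ => snr) 0 0) ∧
    -- more generally, it is zero as soon as every fixed positive rate has too few measurements
    (∀ snr : ℕ → ℝ, (∀ᶠ n in atTop, 0 < snr n) →
      (fun n : ℕ => n * H₂ ((k n : ℝ) / n)) =o[atTop] measurementScale k β snr →
      HasSensingCapacity k β snr 0 0) := by
  exact ⟨fun snr m hsnr hm est => ⟨fun h => zero_ne_one
      (tendsto_nhds_unique h (tendsto_errorProb_one hβ hk hsnr hm est)),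
      tendsto_errorProb_one hβ hk hsnr hm est⟩,
    fun snr hsnr => hasSensingCapacity_zero hβ hk (Eventually.of_forall fun _ => hsnr)
      (rate_isLittleO_measurementScale hβ hk hsnr),
    fun snr hsnr hrate => hasSensingCapacity_zero hβ hk hsnr hrate⟩
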